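/- Let $\mathbb T=\mathbb R/\mathbb Z$ and let $\mathcal C(\mathbb T)$ be the Banach space of continuous complex-valued functions on $\mathbb T$ with the supremum norm. For $f\in\mathcal C(\mathbb T)$ and $n\ge 0$ let $S_nf(x)=\sum_{k=-n}^{n}\hat f(k)e^{2\pi i kx}$, where $\hat f(k)=\int_{\mathbb T} f(t)e^{-2\pi i kt}\,dt$. A Borel set $B\subset\mathcal C(\mathbb T)$ is called Haar-null if there is a compactly supported Borel probability measure $\mu$ on $\mathcal C(\mathbb T)$ with $\mu(g+B)=0$ for every $g\in\mathcal C(\mathbb T)$; an arbitrary subset of $\mathcal C(\mathbb T)$ is called Haar-null if it is contained in a Haar-null Borel set, and the complement of a Haar-null set is called prevalent. Let $(\delta_n)_{n\ge 2}$ be a sequence of positive real numbers tending to $0$. Then the set of all $f\in\mathcal C(\mathbb T)$ with the following property is prevalent: there exists a set $E\subset\mathbb T$ of Hausdorff dimension $1$ such that, for every $x\in E$, $$\limsup_{n\to+\infty}\frac{|S_nf(x)|}{\delta_n\log n}=+\infty.$$ -/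

import Mathlib

open MeasureTheory Filter Topology
open scoped Pointwise

/-- A Borel set `B` of a topological additive group is transverse to some compactly supported
Borel probability measure: every translate `x + B` is a null set of that measure. -/
def IsBorelHaarNull {E : Type*} [AddCommGroup E] [TopologicalSpace E] (B : Set E) : Prop :=
  MeasurableSet[borel E] B ∧
    ∃ μ : @Measure E (borel E), μ Set.univ = 1 ∧ (∃ K : Set E, IsCompact K ∧ μ Kᶜ = 0) ∧
      ∀ x : E, μ (x +ᵥ B) = 0

/-- A set is Haar-null if it is contained in a Borel Haar-null set. -/
def IsHaarNull {E : Type*} [AddCommGroup E] [TopologicalSpace E] (A : Set E) : Prop :=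
  ∃ B : Set E, A ⊆ B ∧ IsBorelHaarNull B

/-- A set is prevalent if its complement is Haar-null. -/
def IsPrevalent {E : Type*} [AddCommGroup E] [TopologicalSpace E] (A : Set E) : Prop :=
  IsHaarNull Aᶜ

/-- The `n`-th symmetric partial sum `∑_{|k| ≤ n} f̂(k) e^{2πikx}` of the Fourier series of a
continuous function on the circle `ℝ/ℤ`. -/
noncomputable def fourierPartialSum (n : ℕ) (f : C(UnitAddCircle, ℂ)) (x : UnitAddCircle) : ℂ :=
  ∑ k ∈ Finset.Icc (-(n : ℤ)) (n : ℤ), fourierCoeff f k * fourier k x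

/-! The probe is a segment `t • h`, `t ∈ [0, 1]`, where `h` diverges at the required rate at
`ν`-almost every point, for a probability `ν` on the circle charging no set of dimension less than
1. If `h` diverges at `x`, then `g + t • h` fails to diverge at `x` for at most one `t`
(`divergenceRate_line_subsingleton`). By Fubini, for almost every `t` divergence holds `ν`-almost
everywhere, hence on a set of dimension 1.

Both `h` and `ν` come from `exists_divergent_on_sparse_digits`. `h` is a lacunary sum of `2⁻ʲ` times
bounded Fejér polynomials with `m = 2 ^ ((j + 1) * b j)` and `K = 2 ^ b j`. The partial sum of order
`n = 2 * m * K` of such a polynomial has size `log K`, comparable to `log n / (j + 2)`, wherever the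
binary digits vanish on a block of length `b j + 3` starting at `(j + 1) * b j`. Taking `b j` large
lets `δ n` absorb the factor `2⁻ʲ / (j + 2)`. The blocks have density zero, so forcing their digits
to vanish and tossing fair coins elsewhere costs no dimension
(`one_le_dimH_of_sparseDigitMeasure_ne_zero`). -/

/-! ### Bounded sine sums -/

/-- The sums `∑_{1 ≤ n ≤ K} Im (z ^ n) / n` are uniformly bounded on the unit circle. -/
lemma abs_im_sum_pow_div_le {K : ℕ} (hK : 0 < K) {z : ℂ} (hz : ‖z‖ = 1) :
    |(∑ k ∈ Finset.range K, z ^ (k + 1) / ((k : ℂ) + 1)).im| ≤ 6 := by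
  have hK' : (1 : ℝ) ≤ K := by exact_mod_cast hK
  -- Abel-type comparison with `-log (1 - r z)`, whose imaginary part is at most `π`. At this radius
  -- the truncation error and the tail are each at most 1, and `1 + 1 + 4 = 6`.
  set r : ℝ := 1 - 1 / K with hr
  have hK1 : 1 / (K : ℝ) ≤ 1 := by rw [div_le_one (by positivity)]; exact hK'
  have hK0 : 0 < 1 / (K : ℝ) := by positivity
  have hr0 : 0 ≤ r := by linarith
  have hr1 : r < 1 := by linarith
  have hw : ‖(r : ℂ) * z‖ = r := by simp [hz, abs_of_nonneg hr0]
  have hs := Complex.hasSum_taylorSeries_neg_log (z := (r : ℂ) * z) (by rw [hw]; exact hr1)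
  have hsplit := hs.summable.sum_add_tsum_nat_add (K + 1)
  rw [hs.tsum_eq, Finset.sum_range_succ'] at hsplit
  simp only [pow_zero, CharP.cast_eq_zero, div_zero, add_zero] at hsplit
  have htail : ‖∑' n : ℕ, ((r : ℂ) * z) ^ (n + (K + 1)) / ((n + (K + 1) : ℕ) : ℂ)‖ ≤ 1 := by
    have hg : HasSum (fun n : ℕ => 1 / (K : ℝ) * r ^ n) (1 / (K : ℝ) * (1 - r)⁻¹) :=
      (hasSum_geometric_of_lt_one hr0 hr1).mul_left _
    have h1 : 1 / (K : ℝ) * (1 - r)⁻¹ = 1 := by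
      rw [hr]; field_simp; simp
    rw [h1] at hg
    refine tsum_of_norm_bounded hg fun n => ?_
    rw [norm_div, norm_pow, hw, Complex.norm_natCast, div_eq_mul_one_div, mul_comm]
    refine mul_le_mul ?_ (pow_le_pow_of_le_one hr0 hr1.le (by omega)) (by positivity)
      (by positivity)
    apply one_div_le_one_div_of_le (by positivity)
    push_cast
    have : (0 : ℝ) ≤ n := by positivity
    linarith
  have hdiff : ‖(∑ k ∈ Finset.range K, z ^ (k + 1) / ((k : ℂ) + 1)) -
      ∑ k ∈ Finset.range K, ((r : ℂ) * z) ^ (k + 1) / ((k + 1 : ℕ) : ℂ)‖ ≤ 1 := by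
    rw [← Finset.sum_sub_distrib]
    have : ∀ k ∈ Finset.range K, ‖z ^ (k + 1) / ((k : ℂ) + 1) -
        ((r : ℂ) * z) ^ (k + 1) / ((k + 1 : ℕ) : ℂ)‖ ≤ 1 / (K : ℝ) := by
      intro k _
      have e : z ^ (k + 1) / ((k : ℂ) + 1) - ((r : ℂ) * z) ^ (k + 1) / ((k + 1 : ℕ) : ℂ) =
          ((1 - r ^ (k + 1) : ℝ) : ℂ) * (z ^ (k + 1) / ((k + 1 : ℕ) : ℂ)) := by
        push_cast; ring
      have hb := one_add_mul_le_pow (a := -(1 / (K : ℝ))) (by linarith) (k + 1)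
      have h1 : r ^ (k + 1) ≤ 1 := pow_le_one₀ hr0 hr1.le
      rw [e, norm_mul, norm_div, norm_pow, hz, one_pow, Complex.norm_natCast, Complex.norm_real,
        Real.norm_of_nonneg (by linarith), mul_one_div, div_le_iff₀ (by positivity)]
      rw [← sub_eq_add_neg, ← hr] at hb
      push_cast at hb ⊢
      linarith
    refine (norm_sum_le_of_le _ this).trans ?_
    simp only [Finset.sum_const, Finset.card_range, nsmul_eq_mul]
    rw [mul_one_div, div_self (by positivity)]
  have hlog : |(-Complex.log (1 - (r : ℂ) * z)).im| ≤ Real.pi := by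
    rw [Complex.neg_im, abs_neg, Complex.log_im]
    exact Complex.abs_arg_le_pi _
  have e : (∑ k ∈ Finset.range K, z ^ (k + 1) / ((k : ℂ) + 1)) =
      ((∑ k ∈ Finset.range K, z ^ (k + 1) / ((k : ℂ) + 1)) -
      ∑ k ∈ Finset.range K, ((r : ℂ) * z) ^ (k + 1) / ((k + 1 : ℕ) : ℂ)) +
      (-Complex.log (1 - (r : ℂ) * z)) -
      ∑' n : ℕ, ((r : ℂ) * z) ^ (n + (K + 1)) / ((n + (K + 1) : ℕ) : ℂ) := by
    rw [← hsplit]; ring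
  rw [e, Complex.sub_im, Complex.add_im]
  have h1 := (Complex.abs_im_le_norm _).trans htail
  have h2 := (Complex.abs_im_le_norm _).trans hdiff
  have h3 := Real.pi_lt_four
  rw [abs_le] at *
  constructor <;> linarith

/-! ### Partial sums as continuous functionals -/

lemma norm_fourier_apply (n : ℤ) (x : UnitAddCircle) : ‖fourier n x‖ = 1 := by
  rw [fourier_apply]; exact Circle.norm_coe _

lemma fourier_mul_natCast (m : ℤ) (k : ℕ) (x : UnitAddCircle) :
    fourier (m * k) x = fourier m x ^ k := by
  induction k with
  | zero => simp
  | succ k ih => rw [Nat.cast_succ, mul_add, mul_one, fourier_add, ih, pow_succ]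

/-- The `k`-th Fourier coefficient as a continuous linear functional. -/
noncomputable def fourierCoeffCLM (k : ℤ) : C(UnitAddCircle, ℂ) →L[ℂ] ℂ :=
  LinearMap.mkContinuous
    { toFun := fun f => fourierCoeff f k
      map_add' := fun f g => congrFun (fourierCoeff.add
        (f.continuous.integrable_of_hasCompactSupport (HasCompactSupport.of_compactSpace _))
        (g.continuous.integrable_of_hasCompactSupport (HasCompactSupport.of_compactSpace _))) k
      map_smul' := fun c f => fourierCoeff.const_smul f c k }
    1 fun f => by
      change ‖fourierCoeff f k‖ ≤ _
      rw [one_mul, fourierCoeff]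
      refine (norm_integral_le_of_norm_le_const (C := ‖f‖) (ae_of_all _ fun t => ?_)).trans
        (by simp)
      rw [norm_smul, norm_fourier_apply, one_mul]
      exact f.norm_coe_le_norm t

/-- The Fourier partial sum at a point, as a continuous linear functional. -/
noncomputable def fourierPartialSumCLM (n : ℕ) (x : UnitAddCircle) :
    C(UnitAddCircle, ℂ) →L[ℂ] ℂ :=
  ∑ k ∈ Finset.Icc (-(n : ℤ)) (n : ℤ), (fourier k x : ℂ) • fourierCoeffCLM k

lemma fourierPartialSumCLM_apply (n : ℕ) (x : UnitAddCircle) (f : C(UnitAddCircle, ℂ)) :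
    fourierPartialSumCLM n x f = fourierPartialSum n f x := by
  rw [fourierPartialSumCLM, fourierPartialSum, _root_.sum_apply]
  exact Finset.sum_congr rfl fun k _ => mul_comm _ _

lemma fourierPartialSum_fourier (n : ℕ) (l : ℤ) (x : UnitAddCircle) :
    fourierPartialSumCLM n x (fourier l) = if |l| ≤ n then fourier l x else 0 := by
  rw [fourierPartialSumCLM_apply, fourierPartialSum]
  simp only [fourierCoeff_fourier, Pi.single_apply, ite_mul, one_mul, zero_mul,
    Finset.sum_ite_eq', Finset.mem_Icc, abs_le]

lemma continuous_fourierPartialSum (n : ℕ) :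
    Continuous fun p : C(UnitAddCircle, ℂ) × UnitAddCircle => fourierPartialSum n p.1 p.2 := by
  unfold fourierPartialSum
  exact continuous_finsetSum _ fun k _ =>
    ((fourierCoeffCLM k).continuous.comp continuous_fst).mul ((fourier k).continuous.comp continuous_snd)

/-! ### Fejér polynomials -/

/-- A bounded trigonometric polynomial with spectrum in `[K m, 3 K m]`, whose partial sum of
order `2 K m` is of size `log K` near the multiples of `1 / m`. -/
noncomputable def fejerPoly (m K : ℕ) : C(UnitAddCircle, ℂ) :=
  ∑ k ∈ Finset.range K, ((k : ℂ) + 1)⁻¹ •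
    (fourier ((m : ℤ) * (2 * K + (k + 1) : ℕ)) - fourier ((m : ℤ) * (2 * K - (k + 1) : ℕ)))

lemma norm_fejerPoly_le (m K : ℕ) : ‖fejerPoly m K‖ ≤ 12 := by
  rcases Nat.eq_zero_or_pos K with rfl | hK
  · simp [fejerPoly]
  rw [ContinuousMap.norm_le _ (by norm_num)]
  intro x
  set z : ℂ := fourier m x with hz
  have hz1 : ‖z‖ = 1 := norm_fourier_apply _ _
  have hcz : z * (starRingEnd ℂ) z = 1 := by
    rw [Complex.mul_conj, Complex.normSq_eq_norm_sq, hz1]; simp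
  -- Opposite coefficients at frequencies symmetric about `2 * K * m` combine into a sine sum.
  have e : fejerPoly m K x = z ^ (2 * K) * (2 * Complex.I *
      ((∑ k ∈ Finset.range K, z ^ (k + 1) / ((k : ℂ) + 1)).im : ℂ)) := by
    simp only [fejerPoly, ContinuousMap.sum_apply, ContinuousMap.smul_apply,
      ContinuousMap.sub_apply, fourier_mul_natCast, ← hz, Complex.im_sum, Complex.ofReal_sum,
      Finset.mul_sum]
    refine Finset.sum_congr rfl fun k hk => ?_
    have hk : k < K := Finset.mem_range.mp hk
    have h1 : z ^ (2 * K - (k + 1)) = z ^ (2 * K) * (starRingEnd ℂ) z ^ (k + 1) := by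
      conv_rhs => rw [show 2 * K = 2 * K - (k + 1) + (k + 1) by omega, pow_add, mul_assoc,
        ← mul_pow, hcz, one_pow, mul_one]
    have h2 : (z ^ (k + 1) / ((k : ℂ) + 1)).im = (z ^ (k + 1)).im / ((k : ℝ) + 1) := by
      have := Complex.div_ofReal_im (z ^ (k + 1)) ((k : ℝ) + 1)
      push_cast at this
      exact this
    have h3 : z ^ (k + 1) - (starRingEnd ℂ) z ^ (k + 1) = 2 * Complex.I * ((z ^ (k + 1)).im : ℂ) := by
      rw [← map_pow (starRingEnd ℂ), Complex.sub_conj]; push_cast; ring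
    rw [h1, h2, pow_add, smul_eq_mul, ← mul_sub, h3]
    push_cast
    ring
  rw [e, norm_mul, norm_pow, hz1, one_pow, one_mul, norm_mul, norm_mul, Complex.norm_I,
    Complex.norm_real, Real.norm_eq_abs]
  have := abs_im_sum_pow_div_le hK hz1
  rw [show ‖(2 : ℂ)‖ = 2 by norm_num]
  linarith

lemma fourierPartialSum_fejerPoly_of_le {m K n : ℕ} (h : 3 * (m * K) ≤ n) (x : UnitAddCircle) :
    fourierPartialSumCLM n x (fejerPoly m K) = fejerPoly m K x := by
  simp only [fejerPoly, map_sum, map_smul, map_sub, fourierPartialSum_fourier,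
    ContinuousMap.sum_apply, ContinuousMap.smul_apply, ContinuousMap.sub_apply]
  refine Finset.sum_congr rfl fun k hk => ?_
  have hk : k < K := Finset.mem_range.mp hk
  rw [if_pos, if_pos]
  · rw [abs_of_nonneg (by positivity)]
    norm_cast
    refine le_trans ?_ h
    rw [mul_left_comm]
    exact Nat.mul_le_mul_left _ (by omega)
  · rw [abs_of_nonneg (by positivity)]
    norm_cast
    refine le_trans ?_ h
    rw [mul_left_comm]
    exact Nat.mul_le_mul_left _ (by omega)

lemma fourierPartialSum_fejerPoly_of_lt {m K n : ℕ} (h : n < m * K) (x : UnitAddCircle) :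
    fourierPartialSumCLM n x (fejerPoly m K) = 0 := by
  simp only [fejerPoly, map_sum, map_smul, map_sub, fourierPartialSum_fourier]
  refine Finset.sum_eq_zero fun k hk => ?_
  have hk : k < K := Finset.mem_range.mp hk
  rw [if_neg, if_neg, sub_zero, smul_zero]
  · rw [abs_of_nonneg (by positivity), not_le]
    norm_cast
    exact h.trans_le (Nat.mul_le_mul_left _ (by omega))
  · rw [abs_of_nonneg (by positivity), not_le]
    norm_cast
    exact h.trans_le (Nat.mul_le_mul_left _ (by omega))

/-- The cutoff at the central frequency keeps only the lower half, so the cancellation is lost. All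
phases satisfy `(k + 1) * θ ≤ 1 / 8`, so each cosine is at least `1 / 2` and a harmonic sum remains.
-/
lemma log_le_norm_fourierPartialSum_fejerPoly {m K : ℕ} (hm : 0 < m) (x : UnitAddCircle)
    {θ : ℝ} (hθ0 : 0 ≤ θ) (hθ : 8 * K * θ ≤ 1)
    (hx : fourier m x = Complex.exp (2 * Real.pi * θ * Complex.I)) :
    Real.log (K + 1) / 2 ≤ ‖fourierPartialSumCLM (2 * (m * K)) x (fejerPoly m K)‖ := by
  set z : ℂ := fourier m x with hz
  have hz1 : ‖z‖ = 1 := norm_fourier_apply _ _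
  have hcz : z * (starRingEnd ℂ) z = 1 := by
    rw [Complex.mul_conj, Complex.normSq_eq_norm_sq, hz1]; simp
  have e : fourierPartialSumCLM (2 * (m * K)) x (fejerPoly m K) = -(z ^ (2 * K) *
      (∑ k ∈ Finset.range K, ((k : ℂ) + 1)⁻¹ * (starRingEnd ℂ) z ^ (k + 1))) := by
    simp only [fejerPoly, map_sum, map_smul, map_sub, fourierPartialSum_fourier, Finset.mul_sum,
      ← Finset.sum_neg_distrib]
    refine Finset.sum_congr rfl fun k hk => ?_
    have hk : k < K := Finset.mem_range.mp hk
    have h1 : z ^ (2 * K - (k + 1)) = z ^ (2 * K) * (starRingEnd ℂ) z ^ (k + 1) := by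
      conv_rhs => rw [show 2 * K = 2 * K - (k + 1) + (k + 1) by omega, pow_add, mul_assoc,
        ← mul_pow, hcz, one_pow, mul_one]
    rw [if_neg, if_pos, zero_sub, fourier_mul_natCast, ← hz, h1, smul_eq_mul]
    · ring
    · rw [abs_of_nonneg (by positivity)]
      norm_cast
      rw [mul_left_comm]
      exact Nat.mul_le_mul_left _ (by omega)
    · rw [abs_of_nonneg (by positivity), not_le]
      norm_cast
      rw [mul_left_comm]
      exact Nat.mul_lt_mul_of_pos_left (by omega) hm
  rw [e, norm_neg, norm_mul, norm_pow, hz1, one_pow, one_mul]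
  refine le_trans ?_ (Complex.re_le_norm _)
  rw [Complex.re_sum]
  have hterm : ∀ k ∈ Finset.range K, ((k : ℝ) + 1)⁻¹ * (1 / 2) ≤
      (((k : ℂ) + 1)⁻¹ * (starRingEnd ℂ) z ^ (k + 1)).re := by
    intro k hk
    have hk : k < K := Finset.mem_range.mp hk
    have hkK : (k : ℝ) + 1 ≤ K := by exact_mod_cast hk
    have h1 : (((k : ℂ) + 1)⁻¹ * (starRingEnd ℂ) z ^ (k + 1)).re =
        ((k : ℝ) + 1)⁻¹ * ((starRingEnd ℂ) z ^ (k + 1)).re := by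
      rw [← Complex.re_ofReal_mul]; push_cast; rfl
    have h2 : ((starRingEnd ℂ) z ^ (k + 1)).re = Real.cos (2 * Real.pi * (((k : ℝ) + 1) * θ)) := by
      rw [← map_pow, Complex.conj_re, hx, ← Complex.exp_nat_mul, ← Complex.exp_ofReal_mul_I_re]
      congr 2; push_cast; ring
    rw [h1, h2]
    refine mul_le_mul_of_nonneg_left ?_ (by positivity)
    rw [← Real.cos_pi_div_three]
    have h3 : ((k : ℝ) + 1) * θ ≤ 1 / 8 := by nlinarith
    have h4 : 0 ≤ ((k : ℝ) + 1) * θ := by positivity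
    have := Real.pi_pos
    apply Real.cos_le_cos_of_nonneg_of_le_pi <;> nlinarith
  refine le_trans ?_ (Finset.sum_le_sum hterm)
  have := log_add_one_le_harmonic K
  rw [← Finset.sum_mul]
  simp only [harmonic, Rat.cast_sum, Rat.cast_inv] at this
  push_cast at this
  linarith

/-! ### Random binary digits vanishing on a sparse set -/

/-- The law of independent fair binary digits, except that the digits with index in `Z` vanish. -/
noncomputable def sparseDigitLaw (Z : Set ℕ) [DecidablePred (· ∈ Z)] (i : ℕ) : Measure (Fin 2) :=
  if i ∈ Z then Measure.dirac 0 else (2⁻¹ : ENNReal) • Measure.count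

instance (Z : Set ℕ) [DecidablePred (· ∈ Z)] (i : ℕ) :
    IsProbabilityMeasure (sparseDigitLaw Z i) := by
  unfold sparseDigitLaw
  split_ifs
  · infer_instance
  · refine ⟨?_⟩
    rw [Measure.smul_apply, Measure.count_univ, smul_eq_mul, ENat.card_eq_coe_fintype_card]
    simpa using ENNReal.inv_mul_cancel two_ne_zero ENNReal.ofNat_ne_top

/-- The product measure on binary sequences vanishing on `Z`, with fair digits elsewhere. -/
noncomputable def sparseCoinMeasure (Z : Set ℕ) [DecidablePred (· ∈ Z)] : Measure (ℕ → Fin 2) :=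
  Measure.infinitePi (sparseDigitLaw Z)

instance (Z : Set ℕ) [DecidablePred (· ∈ Z)] : IsProbabilityMeasure (sparseCoinMeasure Z) := by
  unfold sparseCoinMeasure; infer_instance

/-- The number with given binary digits, as a point of the circle. -/
noncomputable def circleOfDigits (ω : ℕ → Fin 2) : UnitAddCircle := (Real.ofDigits ω : ℝ)

lemma continuous_circleOfDigits : Continuous circleOfDigits :=
  (AddCircle.continuous_mk' 1).comp Real.continuous_ofDigits

/-- The law on the circle of a number with random binary digits vanishing on `Z`. -/
noncomputable def sparseDigitMeasure (Z : Set ℕ) [DecidablePred (· ∈ Z)] :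
    Measure UnitAddCircle :=
  (sparseCoinMeasure Z).map circleOfDigits

instance (Z : Set ℕ) [DecidablePred (· ∈ Z)] : IsProbabilityMeasure (sparseDigitMeasure Z) :=
  Measure.isProbabilityMeasure_map continuous_circleOfDigits.measurable.aemeasurable

lemma ae_sparseCoinMeasure (Z : Set ℕ) [DecidablePred (· ∈ Z)] :
    ∀ᵐ ω ∂sparseCoinMeasure Z, ∀ i ∈ Z, ω i = 0 := by
  rw [ae_all_iff]
  intro i
  by_cases hi : i ∈ Z
  · have h := Measure.infinitePi_map_eval (sparseDigitLaw Z) i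
    have hd : ∀ᵐ d ∂sparseDigitLaw Z i, d = 0 := by
      rw [sparseDigitLaw, if_pos hi, ae_dirac_iff (by measurability)]
    rw [← h] at hd
    filter_upwards [ae_of_ae_map (measurable_pi_apply i).aemeasurable hd] with ω hω _ using hω
  · exact ae_of_all _ fun ω h => absurd h hi

lemma ae_sparseDigitMeasure {Z : Set ℕ} [DecidablePred (· ∈ Z)] {G : Set UnitAddCircle}
    (hG : MeasurableSet G)
    (h : ∀ ω : ℕ → Fin 2, (∀ i ∈ Z, ω i = 0) → circleOfDigits ω ∈ G) :
    ∀ᵐ x ∂sparseDigitMeasure Z, x ∈ G := by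
  refine (ae_map_iff continuous_circleOfDigits.measurable.aemeasurable hG).mpr ?_
  filter_upwards [ae_sparseCoinMeasure Z] with ω hω using h ω hω

/-- The number of indices below `N` in `Z`. -/
def countBelow (Z : Set ℕ) [DecidablePred (· ∈ Z)] (N : ℕ) : ℕ :=
  ((Finset.range N).filter (· ∈ Z)).card

lemma sparseCoinMeasure_cylinder_le (Z : Set ℕ) [DecidablePred (· ∈ Z)] (N : ℕ) (p : ℕ → Fin 2) :
    sparseCoinMeasure Z {ω | ∀ i < N, ω i = p i} ≤ 2⁻¹ ^ (N - countBelow Z N) := by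
  have e : {ω : ℕ → Fin 2 | ∀ i < N, ω i = p i} =
      Set.pi (Finset.range N : Set ℕ) fun i => {p i} := by
    ext ω; simp
  rw [e, sparseCoinMeasure, Measure.infinitePi_pi _ (fun i _ => by measurability)]
  have hle : ∀ i ∈ Finset.range N, sparseDigitLaw Z i {p i} ≤
      if i ∈ Z then (1 : ENNReal) else 2⁻¹ := by
    intro i _
    split_ifs with h
    · exact prob_le_one
    · rw [sparseDigitLaw, if_neg h, Measure.smul_apply, Measure.count_singleton, smul_eq_mul,
        mul_one]
  refine (Finset.prod_le_prod' hle).trans ?_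
  rw [Finset.prod_ite, Finset.prod_const_one, one_mul, Finset.prod_const]
  apply le_of_eq
  congr 1
  have := Finset.card_filter_add_card_filter_not (s := Finset.range N) (· ∈ Z)
  rw [Finset.card_range] at this
  unfold countBelow
  omega

/-- The integer with binary digits the first `N` terms of a sequence. -/
def prefixNat (ω : ℕ → Fin 2) : ℕ → ℕ
  | 0 => 0
  | N + 1 => 2 * prefixNat ω N + ω N

lemma eq_of_prefixNat_eq {ω ω' : ℕ → Fin 2} {N : ℕ} (h : prefixNat ω N = prefixNat ω' N) :
    ∀ i < N, ω i = ω' i := by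
  induction N with
  | zero => intro i hi; omega
  | succ N ih =>
    simp only [prefixNat] at h
    have h1 := (ω N).isLt
    have h2 := (ω' N).isLt
    intro i hi
    rcases Nat.lt_succ_iff_lt_or_eq.mp hi with hi | rfl
    · exact ih (by omega) i hi
    · exact Fin.ext (by omega)

lemma sum_ofDigitsTerm_eq (ω : ℕ → Fin 2) (N : ℕ) :
    ∑ i ∈ Finset.range N, Real.ofDigitsTerm ω i = prefixNat ω N / 2 ^ N := by
  induction N with
  | zero => simp [prefixNat]
  | succ N ih =>
    rw [Finset.sum_range_succ, ih, prefixNat, Real.ofDigitsTerm]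
    push_cast
    field_simp
    ring

/-- Both inequalities are weak: a tail of ones gives equality on the right, so the prefix need not
be the floor. -/
lemma prefixNat_le_ofDigits (ω : ℕ → Fin 2) (N : ℕ) :
    (prefixNat ω N : ℝ) ≤ 2 ^ N * Real.ofDigits ω ∧
      2 ^ N * Real.ofDigits ω ≤ prefixNat ω N + 1 := by
  have h := Real.ofDigits_eq_sum_add_ofDigits ω N
  rw [sum_ofDigitsTerm_eq] at h
  have h0 := Real.ofDigits_nonneg fun i => ω (i + N)
  have h1 := Real.ofDigits_le_one fun i => ω (i + N)
  have e : 2 ^ N * Real.ofDigits ω = prefixNat ω N + Real.ofDigits fun i => ω (i + N) := by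
    rw [h]; push_cast; field_simp
  constructor <;> linarith

lemma sparseCoinMeasure_prefixNat_le (Z : Set ℕ) [DecidablePred (· ∈ Z)] (N k : ℕ) :
    sparseCoinMeasure Z {ω | prefixNat ω N = k} ≤ 2⁻¹ ^ (N - countBelow Z N) := by
  rcases Set.eq_empty_or_nonempty {ω : ℕ → Fin 2 | prefixNat ω N = k} with h | ⟨p, hp⟩
  · rw [h, measure_empty]; exact zero_le
  · refine (measure_mono fun ω hω => ?_).trans (sparseCoinMeasure_cylinder_le Z N p)
    exact eq_of_prefixNat_eq (hω.trans hp.symm)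

lemma ofDigits_le_half {ω : ℕ → Fin 2} (h : ω 0 = 0) : Real.ofDigits ω ≤ 1 / 2 := by
  have := (prefixNat_le_ofDigits ω 1).2
  simp [prefixNat, h] at this
  linarith

/-- A set this small meets at most three consecutive dyadic prefixes. The condition `0 ∈ Z` confines
the points to `[0, 1/2]`, where circle distance is real distance, without wraparound. -/
lemma sparseDigitMeasure_le {Z : Set ℕ} [DecidablePred (· ∈ Z)] (h0 : 0 ∈ Z)
    (U : Set UnitAddCircle) (N : ℕ) (hU : Metric.ediam U < ENNReal.ofReal (2 ^ N)⁻¹) :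
    sparseDigitMeasure Z U ≤ 3 * 2⁻¹ ^ (N - countBelow Z N) := by
  -- The closure has the same diameter and is measurable, while `U` is arbitrary.
  rw [← Metric.ediam_closure] at hU
  refine (measure_mono subset_closure).trans ?_
  rw [sparseDigitMeasure, Measure.map_apply continuous_circleOfDigits.measurable
    isClosed_closure.measurableSet]
  set A := (circleOfDigits ⁻¹' closure U) ∩ {ω | ω 0 = 0} with hA
  have hmono : sparseCoinMeasure Z (circleOfDigits ⁻¹' closure U) ≤ sparseCoinMeasure Z A := by
    refine measure_mono_ae ?_
    filter_upwards [ae_sparseCoinMeasure Z] with ω hω h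
    exact ⟨h, hω 0 h0⟩
  refine hmono.trans ?_
  rcases A.eq_empty_or_nonempty with h | ⟨p, hp⟩
  · rw [h, measure_empty]; exact zero_le
  -- Truncated subtraction is harmless: for prefix 0 the third set repeats the first.
  have hsub : A ⊆ {ω | prefixNat ω N = prefixNat p N} ∪
      ({ω | prefixNat ω N = prefixNat p N + 1} ∪ {ω | prefixNat ω N = prefixNat p N - 1}) := by
    intro ω hω
    have hωU : circleOfDigits ω ∈ closure U := hω.1
    have hpU : circleOfDigits p ∈ closure U := hp.1
    have hd : edist (circleOfDigits ω) (circleOfDigits p) < ENNReal.ofReal (2 ^ N)⁻¹ :=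
      (Metric.edist_le_ediam_of_mem hωU hpU).trans_lt hU
    have hω2 := ofDigits_le_half hω.2
    have hp2 := ofDigits_le_half hp.2
    have hω1 := Real.ofDigits_nonneg ω
    have hp1 := Real.ofDigits_nonneg p
    have hn : ‖((Real.ofDigits ω - Real.ofDigits p : ℝ) : UnitAddCircle)‖ =
        |Real.ofDigits ω - Real.ofDigits p| := by
      rw [AddCircle.norm_coe_eq_abs_iff 1 one_ne_zero, abs_one, abs_le]
      constructor <;> linarith
    rw [edist_dist, ENNReal.ofReal_lt_ofReal_iff (by positivity), dist_eq_norm, circleOfDigits,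
      circleOfDigits, ← AddCircle.coe_sub, hn, abs_lt] at hd
    have a1 := prefixNat_le_ofDigits ω N
    have a2 := prefixNat_le_ofDigits p N
    have hpow : (0 : ℝ) < 2 ^ N := by positivity
    have b1 : 2 ^ N * (Real.ofDigits ω - Real.ofDigits p) < 1 := by
      have := mul_lt_mul_of_pos_left hd.2 hpow
      rwa [mul_inv_cancel₀ hpow.ne'] at this
    have b2 : -1 < 2 ^ N * (Real.ofDigits ω - Real.ofDigits p) := by
      have := mul_lt_mul_of_pos_left hd.1 hpow
      rwa [mul_neg, mul_inv_cancel₀ hpow.ne'] at this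
    have c1 : prefixNat ω N < prefixNat p N + 2 := by
      have : (prefixNat ω N : ℝ) < prefixNat p N + 2 := by linarith
      exact_mod_cast this
    have c2 : prefixNat p N < prefixNat ω N + 2 := by
      have : (prefixNat p N : ℝ) < prefixNat ω N + 2 := by linarith
      exact_mod_cast this
    simp only [Set.mem_union, Set.mem_ofPred_eq]
    omega
  refine (measure_mono hsub).trans ((measure_union_le _ _).trans
    ((add_le_add le_rfl (measure_union_le _ _)).trans ?_))
  have := sparseCoinMeasure_prefixNat_le Z N
  refine (add_le_add (this _) (add_le_add (this _) (this _))).trans (le_of_eq ?_)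
  ring

/-! ### Mass distribution principle -/

/-- If `Z` has density zero, then `sparseDigitMeasure Z` charges no set of dimension `< 1`. -/
theorem one_le_dimH_of_sparseDigitMeasure_ne_zero {Z : Set ℕ} [DecidablePred (· ∈ Z)]
    (h0 : 0 ∈ Z)
    (hZ : ∀ η : ℝ, 0 < η → ∀ᶠ N : ℕ in atTop, (countBelow Z N : ℝ) ≤ η * N)
    {E : Set UnitAddCircle} (hE : sparseDigitMeasure Z E ≠ 0) : 1 ≤ dimH E := by
  refine le_of_forall_lt fun c hc => ?_
  obtain ⟨s, hcs, hs1⟩ := ENNReal.lt_iff_exists_nnreal_btwn.mp hc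
  refine hcs.trans_le (le_dimH_of_hausdorffMeasure_ne_zero ?_)
  have hs0 : (0 : ℝ) < s := by
    have : (0 : ENNReal) < s := (zero_le).trans_lt hcs
    exact_mod_cast this
  have hs1 : (s : ℝ) < 1 := by exact_mod_cast hs1
  -- These constants give `2 - (N - countBelow Z N) ≤ -s * (N + 2)`; the 2 on the left pays for `3 ≤
  -- 2 ^ 2`.
  obtain ⟨N₀, hN₀⟩ := eventually_atTop.mp ((hZ ((1 - s) / 2) (by linarith)).and
    (tendsto_natCast_atTop_atTop.eventually_ge_atTop (8 / (1 - (s : ℝ)))))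
  have key : ∀ N ≥ N₀, ∀ U : Set UnitAddCircle, Metric.ediam U < ENNReal.ofReal (2 ^ N)⁻¹ →
      sparseDigitMeasure Z U ≤ ENNReal.ofReal (((2 : ℝ) ^ (N + 2))⁻¹ ^ (s : ℝ)) := by
    intro N hN U hU
    refine (sparseDigitMeasure_le h0 U N hU).trans ?_
    obtain ⟨hz, hN8⟩ := hN₀ N hN
    rw [div_le_iff₀ (by linarith)] at hN8
    have hzN : countBelow Z N ≤ N := by
      simpa [countBelow] using Finset.card_filter_le (Finset.range N) (· ∈ Z)
    have e : (3 * 2⁻¹ ^ (N - countBelow Z N) : ENNReal) =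
        ENNReal.ofReal (3 * 2⁻¹ ^ (N - countBelow Z N)) := by
      rw [ENNReal.ofReal_mul (by norm_num), ENNReal.ofReal_pow (by norm_num),
        ENNReal.ofReal_inv_of_pos (by norm_num)]
      simp
    rw [e]
    apply ENNReal.ofReal_le_ofReal
    have e1 : ((2 : ℝ)⁻¹ ^ (N - countBelow Z N)) = (2 : ℝ) ^ (-((N : ℝ) - countBelow Z N)) := by
      rw [← Nat.cast_sub hzN, Real.rpow_neg (by norm_num), Real.rpow_natCast, inv_pow]
    have e2 : (((2 : ℝ) ^ (N + 2))⁻¹ ^ (s : ℝ)) = (2 : ℝ) ^ (-(s * ((N : ℝ) + 2))) := by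
      rw [← Real.rpow_natCast, ← Real.rpow_neg (by norm_num), ← Real.rpow_mul (by norm_num)]
      push_cast; congr 1; ring
    rw [e1, e2]
    calc (3 : ℝ) * 2 ^ (-((N : ℝ) - countBelow Z N))
        ≤ (2 : ℝ) ^ (2 : ℝ) * 2 ^ (-((N : ℝ) - countBelow Z N)) := by
          gcongr; norm_num
      _ = (2 : ℝ) ^ (2 + -((N : ℝ) - countBelow Z N)) := by rw [Real.rpow_add (by norm_num)]
      _ ≤ _ := by
          apply Real.rpow_le_rpow_of_exponent_le (by norm_num)
          linarith
  have hle : sparseDigitMeasure Z ≤ Measure.hausdorffMeasure (s : ℝ) := by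
    refine Measure.le_hausdorffMeasure _ _ (ENNReal.ofReal (2 ^ (N₀ + 1))⁻¹)
      (by rw [ENNReal.ofReal_pos]; positivity) fun U hU => ?_
    have hfin : Metric.ediam U ≠ ⊤ := ne_top_of_le_ne_top ENNReal.ofReal_ne_top hU
    set D := (Metric.ediam U).toReal with hD
    have hUD : Metric.ediam U = ENNReal.ofReal D := (ENNReal.ofReal_toReal hfin).symm
    have hD0 : 0 ≤ D := ENNReal.toReal_nonneg
    rw [hUD, ENNReal.ofReal_le_ofReal_iff (by positivity)] at hU
    rw [hUD, ENNReal.ofReal_rpow_of_nonneg hD0 hs0.le]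
    rcases hD0.eq_or_lt with hD0 | hD0
    · rw [← hD0, Real.zero_rpow hs0.ne', ENNReal.ofReal_zero]
      -- Diameter zero: the bound holds at every large scale, so let `N → ∞`.
      refine ge_of_tendsto (x := atTop) (f := fun N : ℕ =>
        ENNReal.ofReal (((2 : ℝ) ^ (N + 2))⁻¹ ^ (s : ℝ))) ?_ ?_
      · rw [← ENNReal.ofReal_zero]
        refine ENNReal.tendsto_ofReal ?_
        have h1 : Tendsto (fun N : ℕ => ((2 : ℝ) ^ (N + 2))⁻¹) atTop (𝓝 0) := by
          have := (tendsto_pow_atTop_nhds_zero_of_lt_one (r := (2 : ℝ)⁻¹) (by norm_num)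
            (by norm_num)).comp (tendsto_add_atTop_nat 2)
          refine this.congr fun N => ?_
          simp
        have := h1.rpow_const (p := (s : ℝ)) (Or.inr hs0.le)
        rwa [Real.zero_rpow hs0.ne'] at this
      · filter_upwards [eventually_ge_atTop N₀] with N hN
        refine key N hN U ?_
        rw [hUD, ← hD0, ENNReal.ofReal_zero, ENNReal.ofReal_pos]
        positivity
    · have hU' : 2 * D ≤ 2⁻¹ ^ N₀ := by
        rw [← inv_pow, pow_succ] at hU
        linarith
      -- Doubling `D` makes `D < 2⁻ⁿ` strict, as `key` requires, and leaves `2 ^ (-(n + 2)) < D`,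
      -- whence the `N + 2` in `key`.
      obtain ⟨n, hn1, hn2⟩ := exists_nat_pow_near_of_lt_one (mul_pos two_pos hD0)
        (hU'.trans (pow_le_one₀ (by norm_num) (by norm_num)))
        (show (0 : ℝ) < 2⁻¹ by norm_num) (show (2 : ℝ)⁻¹ < 1 by norm_num)
      have hn : N₀ ≤ n := by
        by_contra hcon
        have : ((2 : ℝ)⁻¹) ^ N₀ ≤ 2⁻¹ ^ (n + 1) :=
          pow_le_pow_of_le_one (by norm_num) (by norm_num) (by omega)
        linarith
      refine (key n hn U ?_).trans (ENNReal.ofReal_le_ofReal ?_)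
      · rw [hUD, ENNReal.ofReal_lt_ofReal_iff (by positivity), ← inv_pow]
        linarith
      · rw [← inv_pow]
        refine Real.rpow_le_rpow (by positivity) ?_ hs0.le
        rw [pow_succ]
        linarith
  intro h
  exact hE (le_antisymm ((hle E).trans h.le) (zero_le))

/-! ### Lacunary Fejér series -/

/-- A lacunary series of Fejér polynomials. -/
noncomputable def fejerSeries (m K : ℕ → ℕ) : C(UnitAddCircle, ℂ) :=
  ∑' j, ((2 : ℂ)⁻¹ ^ j) • fejerPoly (m j) (K j)

lemma norm_smul_fejerPoly_le (m K : ℕ → ℕ) (j : ℕ) :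
    ‖((2 : ℂ)⁻¹ ^ j) • fejerPoly (m j) (K j)‖ ≤ 2⁻¹ ^ j * 12 := by
  rw [norm_smul, norm_pow, norm_inv, Complex.norm_ofNat]
  gcongr
  exact norm_fejerPoly_le _ _

lemma hasSum_geometric_two_inv_mul : HasSum (fun j : ℕ => (2 : ℝ)⁻¹ ^ j * 12) 24 := by
  have := (hasSum_geometric_of_lt_one (r := (2 : ℝ)⁻¹) (by norm_num) (by norm_num)).mul_right 12
  rwa [show (1 - (2 : ℝ)⁻¹)⁻¹ * 12 = 24 by norm_num] at this

lemma summable_fejerSeries (m K : ℕ → ℕ) :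
    Summable fun j => ((2 : ℂ)⁻¹ ^ j) • fejerPoly (m j) (K j) :=
  Summable.of_norm_bounded hasSum_geometric_two_inv_mul.summable (norm_smul_fejerPoly_le m K)

/-- At this order the earlier polynomials are reproduced in full and the later ones vanish, so all
terms but the `j`-th contribute at most `∑ 12 * 2⁻ⁱ = 24`. -/
lemma le_norm_fourierPartialSum_fejerSeries {m K : ℕ → ℕ}
    (hmK : ∀ i j, i < j → 2 * (m i * K i) < m j * K j) (j : ℕ) (x : UnitAddCircle) :
    2⁻¹ ^ j * ‖fourierPartialSumCLM (2 * (m j * K j)) x (fejerPoly (m j) (K j))‖ - 24 ≤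
      ‖fourierPartialSumCLM (2 * (m j * K j)) x (fejerSeries m K)‖ := by
  set S := fourierPartialSumCLM (2 * (m j * K j)) x
  have hsum := S.hasSum (summable_fejerSeries m K).hasSum
  have hb : ∀ i, ‖if i = j then 0 else S (((2 : ℂ)⁻¹ ^ i) • fejerPoly (m i) (K i))‖ ≤
      2⁻¹ ^ i * 12 := by
    intro i
    rcases lt_trichotomy i j with h | rfl | h
    · rw [if_neg h.ne, map_smul, fourierPartialSum_fejerPoly_of_le (by have := hmK i j h; omega),
        ← ContinuousMap.smul_apply]
      exact (ContinuousMap.norm_coe_le_norm _ x).trans (norm_smul_fejerPoly_le m K i)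
    · simp
    · rw [if_neg h.ne', map_smul, fourierPartialSum_fejerPoly_of_lt (hmK j i h), smul_zero,
        norm_zero]
      positivity
  have htail := tsum_of_norm_bounded hasSum_geometric_two_inv_mul hb
  have e : S (fejerSeries m K) = S (((2 : ℂ)⁻¹ ^ j) • fejerPoly (m j) (K j)) +
      ∑' i, if i = j then 0 else S (((2 : ℂ)⁻¹ ^ i) • fejerPoly (m i) (K i)) := by
    rw [← hsum.summable.tsum_eq_add_tsum_ite j]
    exact hsum.tsum_eq.symm
  have e2 : ‖S (((2 : ℂ)⁻¹ ^ j) • fejerPoly (m j) (K j))‖ =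
      2⁻¹ ^ j * ‖S (fejerPoly (m j) (K j))‖ := by
    rw [map_smul, norm_smul, norm_pow, norm_inv, Complex.norm_ofNat]
  rw [e, ← e2]
  have := norm_sub_le_norm_add (S (((2 : ℂ)⁻¹ ^ j) • fejerPoly (m j) (K j)))
    (∑' i, if i = j then 0 else S (((2 : ℂ)⁻¹ ^ i) • fejerPoly (m i) (K i)))
  linarith

lemma prefixNat_eq_zero {ω : ℕ → Fin 2} {N : ℕ} (h : ∀ i < N, ω i = 0) : prefixNat ω N = 0 := by
  induction N with
  | zero => rfl
  | succ N ih =>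
    rw [prefixNat, ih fun i hi => h i (by omega), h N (by omega)]
    rfl

/-- Multiplication by `2 ^ a` shifts the digits modulo 1; `b + 3` leading zeros then leave `θ ≤ 2 ^
(-(b + 3))`. -/
lemma exists_fourier_circleOfDigits_eq {ω : ℕ → Fin 2} {a b : ℕ}
    (h : ∀ i, a ≤ i → i < a + b + 3 → ω i = 0) :
    ∃ θ : ℝ, 0 ≤ θ ∧ 8 * (2 ^ b : ℕ) * θ ≤ 1 ∧
      fourier ((2 ^ a : ℕ) : ℤ) (circleOfDigits ω) =
        Complex.exp (2 * Real.pi * θ * Complex.I) := by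
  refine ⟨Real.ofDigits fun i => ω (i + a), Real.ofDigits_nonneg _, ?_, ?_⟩
  · have h1 := (prefixNat_le_ofDigits (fun i => ω (i + a)) (b + 3)).2
    rw [prefixNat_eq_zero fun i hi => h (i + a) (by omega) (by omega), pow_add] at h1
    push_cast at h1 ⊢
    linarith
  · have h1 := Real.ofDigits_eq_sum_add_ofDigits ω a
    rw [sum_ofDigitsTerm_eq] at h1
    rw [circleOfDigits, fourier_coe_apply, h1]
    set τ := Real.ofDigits fun i => ω (i + a)
    have e : 2 * (Real.pi : ℂ) * Complex.I * (((2 ^ a : ℕ) : ℤ) : ℂ) *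
        (((prefixNat ω a / 2 ^ a + (((2 : ℕ) : ℝ) ^ a)⁻¹ * τ : ℝ)) : ℂ) / ((1 : ℝ) : ℂ) =
        2 * Real.pi * τ * Complex.I + (prefixNat ω a : ℕ) * (2 * Real.pi * Complex.I) := by
      push_cast
      field_simp
      ring
    rw [e, Complex.exp_add, Complex.exp_nat_mul, Complex.exp_two_pi_mul_I, one_pow, mul_one]

/-! ### Density of the blocks and choice of scales -/

/-- The union of the blocks `[(j + 1) b j, (j + 2) b j + 3)` and `{0}`. -/
def blockSet (b : ℕ → ℕ) : Set ℕ :=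
  {i | i = 0 ∨ ∃ j, (j + 1) * b j ≤ i ∧ i < (j + 1) * b j + b j + 3}

/-- If block `j` is the last to start before `N`, superincreasing growth bounds all blocks so far by
`6 * b j`, whereas `N > (j + 1) * b j`. -/
lemma countBelow_blockSet_le {b : ℕ → ℕ} [DecidablePred (· ∈ blockSet b)] (hb : ∀ j, 1 ≤ b j)
    (hb' : ∀ j, 2 * b j + 3 ≤ b (j + 1)) {η : ℝ} (hη : 0 < η) :
    ∀ᶠ N : ℕ in atTop, (countBelow (blockSet b) N : ℝ) ≤ η * N := by
  have hsum : ∀ j, ∑ i ∈ Finset.range j, (b i + 3) ≤ b j := by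
    intro j
    induction j with
    | zero => simp
    | succ j ih => rw [Finset.sum_range_succ]; have := hb' j; omega
  have hmono : StrictMono b := strictMono_nat_of_lt_succ fun j => by have := hb' j; omega
  have hamono : StrictMono fun j => (j + 1) * b j := fun i j hij =>
    Nat.mul_lt_mul'' (by omega) (hmono hij)
  obtain ⟨J, hJ⟩ := exists_nat_ge (6 / η)
  rw [div_le_iff₀ hη] at hJ
  filter_upwards [eventually_gt_atTop ((J + 1) * b J)] with N hN
  have hex : ∃ j, N ≤ (j + 1) * b j := ⟨N, hamono.id_le N⟩
  obtain ⟨j, hj⟩ : ∃ j, Nat.find hex = j + 1 := by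
    refine Nat.exists_eq_succ_of_ne_zero fun h0 => ?_
    have h1 := Nat.find_spec hex
    rw [h0] at h1
    have := hamono.monotone (Nat.zero_le J)
    omega
  have hspec := Nat.find_spec hex
  rw [hj] at hspec
  have hmin : (j + 1) * b j < N := not_le.mp (Nat.find_min hex (by omega))
  have hJj : J ≤ j := by
    by_contra hcon
    have := hamono.monotone (show j + 1 ≤ J by omega)
    omega
  have hcard : countBelow (blockSet b) N ≤ 1 + ∑ i ∈ Finset.range (j + 1), (b i + 3) := by
    have hsub : (Finset.range N).filter (· ∈ blockSet b) ⊆ {0} ∪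
        (Finset.range (j + 1)).biUnion
          fun i => Finset.Ico ((i + 1) * b i) ((i + 1) * b i + b i + 3) := by
      intro i hi
      rw [Finset.mem_filter, Finset.mem_range] at hi
      rw [Finset.mem_union, Finset.mem_singleton, Finset.mem_biUnion]
      rcases hi.2 with h | ⟨k, hk1, hk2⟩
      · exact Or.inl h
      · refine Or.inr ⟨k, ?_, Finset.mem_Ico.mpr ⟨hk1, hk2⟩⟩
        rw [Finset.mem_range]
        by_contra hcon
        have := hamono.monotone (show j + 1 ≤ k by omega)
        omega
    refine (Finset.card_le_card hsub).trans ((Finset.card_union_le _ _).trans ?_)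
    rw [Finset.card_singleton]
    refine Nat.add_le_add_left (Finset.card_biUnion_le.trans (Finset.sum_le_sum fun i _ => ?_)) _
    rw [Nat.card_Ico]
    omega
  rw [Finset.sum_range_succ] at hcard
  have h6 : countBelow (blockSet b) N ≤ 6 * b j := by
    have := hsum j
    have := hb j
    omega
  have h6' : (countBelow (blockSet b) N : ℝ) ≤ 6 * b j := by exact_mod_cast h6
  have hmin' : ((j : ℝ) + 1) * b j < N := by exact_mod_cast hmin
  have hJj' : (J : ℝ) ≤ j := by exact_mod_cast hJj
  have hbj : (0 : ℝ) ≤ b j := by positivity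
  calc (countBelow (blockSet b) N : ℝ) ≤ 6 * b j := h6'
    _ ≤ (J * η) * b j := by gcongr
    _ ≤ ((j + 1) * η) * b j := by gcongr; linarith
    _ = η * ((j + 1) * b j) := by ring
    _ ≤ η * N := by gcongr

lemma exists_lacunary_seq {P : ℕ → ℕ → Prop} (hP : ∀ j, ∀ᶠ n in atTop, P j n) :
    ∃ b : ℕ → ℕ, (∀ j, 1 ≤ b j) ∧ (∀ j, 2 * b j + 3 ≤ b (j + 1)) ∧ ∀ j, P j (b j) := by
  choose T hT using fun j => eventually_atTop.mp (hP j)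
  let b : ℕ → ℕ := fun j => Nat.rec (max 1 (T 0)) (fun j c => max (2 * c + 3) (T (j + 1))) j
  have hs : ∀ j, b (j + 1) = max (2 * b j + 3) (T (j + 1)) := fun _ => rfl
  refine ⟨b, fun j => ?_, fun j => (hs j).symm ▸ le_max_left _ _, fun j => hT j _ ?_⟩
  · cases j with
    | zero => exact le_max_left _ _
    | succ j => rw [hs]; omega
  · cases j with
    | zero => exact le_max_right _ _
    | succ j => rw [hs]; exact le_max_right _ _

/-- For fixed `j` both logarithms are linear in `b`, so `δ → 0` wins. The factor `j` on the left
makes the final limsup infinite. -/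
lemma eventually_mul_log_le {δ : ℕ → ℝ} (hlim : Tendsto δ atTop (𝓝 0)) (j : ℕ) :
    ∀ᶠ b : ℕ in atTop,
      (j : ℝ) * (δ (2 * (2 ^ ((j + 1) * b) * 2 ^ b)) *
        Real.log (2 * (2 ^ ((j + 1) * b) * 2 ^ b) : ℕ)) ≤
      2⁻¹ ^ j * (Real.log ((2 ^ b : ℕ) + 1) / 2) - 24 := by
  have hn : Tendsto (fun b : ℕ => 2 * (2 ^ ((j + 1) * b) * 2 ^ b)) atTop atTop := by
    refine tendsto_atTop_mono (fun b => ?_) tendsto_id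
    have h1 : b < 2 ^ b := Nat.lt_two_pow_self
    have h2 : 1 ≤ 2 ^ ((j + 1) * b) := Nat.one_le_two_pow
    simp only [id]
    nlinarith
  have hl : 0 < Real.log 2 := Real.log_pos (by norm_num)
  -- The main term is at least `2⁻ʲ * b * log 2 / 2`. The left side and the constant 24 are each
  -- held to `2⁻ʲ * b * log 2 / 8`.
  have hε : (0 : ℝ) < 2⁻¹ ^ j / (8 * (j + 1) * (j + 3)) := by positivity
  filter_upwards [(hlim.comp hn).eventually_lt_const hε, eventually_ge_atTop 1,
    tendsto_natCast_atTop_atTop.eventually_ge_atTop (24 / (2⁻¹ ^ j * Real.log 2 / 8))] with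
    b h1 h2 h3
  rw [div_le_iff₀ (by positivity)] at h3
  have h2' : (1 : ℝ) ≤ b := by exact_mod_cast h2
  have e1 : Real.log (2 * (2 ^ ((j + 1) * b) * 2 ^ b) : ℕ) = ((j + 2) * b + 1) * Real.log 2 := by
    rw [← pow_add, ← pow_succ', Nat.cast_pow, Real.log_pow]
    push_cast
    ring
  have e2 : b * Real.log 2 ≤ Real.log ((2 ^ b : ℕ) + 1) := by
    rw [← Real.log_pow]
    refine Real.log_le_log (by positivity) ?_
    push_cast
    linarith
  rw [e1]
  simp only [Function.comp] at h1
  set d := δ (2 * (2 ^ ((j + 1) * b) * 2 ^ b))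
  have hL : ((j : ℝ) + 2) * b + 1 ≤ (j + 3) * b := by linarith
  have h4 : (j : ℝ) * (d * (((j + 2) * b + 1) * Real.log 2)) ≤ 2⁻¹ ^ j * (b * Real.log 2) / 8 := by
    calc (j : ℝ) * (d * (((j + 2) * b + 1) * Real.log 2))
        ≤ (j : ℝ) * (2⁻¹ ^ j / (8 * (j + 1) * (j + 3)) * (((j + 2) * b + 1) * Real.log 2)) := by
          gcongr
      _ ≤ (j + 1 : ℝ) * (2⁻¹ ^ j / (8 * (j + 1) * (j + 3)) * (((j + 3) * b) * Real.log 2)) := by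
          gcongr
          linarith
      _ = 2⁻¹ ^ j * (b * Real.log 2) / 8 := by field_simp
  have h5 : (2 : ℝ)⁻¹ ^ j * (b * Real.log 2 / 2) ≤
      2⁻¹ ^ j * (Real.log ((2 ^ b : ℕ) + 1) / 2) := by gcongr
  linarith

lemma limsup_coe_eq_top_iff {u : ℕ → ℝ} :
    limsup (fun n => (u n : EReal)) atTop = ⊤ ↔ ∀ M : ℝ, ∃ᶠ n in atTop, M ≤ u n := by
  constructor
  · intro h M hM
    have : limsup (fun n => (u n : EReal)) atTop ≤ (M : EReal) :=
      limsup_le_of_le (by isBoundedDefault) (hM.mono fun n hn => by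
        exact_mod_cast (not_le.mp hn).le)
    rw [h] at this
    exact EReal.coe_ne_top M (top_le_iff.mp this)
  · intro h
    refine EReal.eq_top_iff_forall_lt _ |>.mpr fun M => ?_
    have : ((M + 1 : ℝ) : EReal) ≤ limsup (fun n => (u n : EReal)) atTop :=
      le_limsup_of_frequently_le ((h (M + 1)).mono fun n hn => by exact_mod_cast hn)
    refine lt_of_lt_of_le ?_ this
    exact_mod_cast lt_add_one M

/-- For every `δ → 0` there are a density-zero set `Z` of binary places and a continuous function
whose partial sums are not `O(δ n log n)` at any point whose binary digits vanish on `Z`. -/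
theorem exists_divergent_on_sparse_digits {δ : ℕ → ℝ} (hpos : ∀ n : ℕ, 2 ≤ n → 0 < δ n)
    (hlim : Tendsto δ atTop (𝓝 0)) :
    ∃ (Z : Set ℕ) (_ : DecidablePred (· ∈ Z)) (h : C(UnitAddCircle, ℂ)), 0 ∈ Z ∧
      (∀ η : ℝ, 0 < η → ∀ᶠ N : ℕ in atTop, (countBelow Z N : ℝ) ≤ η * N) ∧
      ∀ ω : ℕ → Fin 2, (∀ i ∈ Z, ω i = 0) → limsup (fun n : ℕ =>
        ((‖fourierPartialSum n h (circleOfDigits ω)‖ / (δ n * Real.log n) : ℝ) : EReal)) atTop =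
          ⊤ := by
  classical
  obtain ⟨b, hb1, hb2, hb3⟩ := exists_lacunary_seq (eventually_mul_log_le hlim)
  have hmono : StrictMono b := strictMono_nat_of_lt_succ fun j => by have := hb2 j; omega
  refine ⟨blockSet b, inferInstance,
    fejerSeries (fun j => 2 ^ ((j + 1) * b j)) (fun j => 2 ^ b j), Or.inl rfl,
    fun η hη => countBelow_blockSet_le hb1 hb2 hη, fun ω hω => ?_⟩
  rw [limsup_coe_eq_top_iff]
  intro M
  rw [frequently_atTop]
  intro N
  obtain ⟨j, hj⟩ := exists_nat_ge (max M N)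
  have hjM : M ≤ j := (le_max_left _ _).trans hj
  have hjN : N ≤ j := by exact_mod_cast (le_max_right _ _).trans hj
  set n : ℕ := 2 * (2 ^ ((j + 1) * b j) * 2 ^ b j) with hn
  have hn_pow : n = 2 ^ ((j + 1) * b j + b j + 1) := by rw [hn, ← pow_add, ← pow_succ']
  have hn2 : 2 ≤ n := by
    rw [hn_pow]; exact Nat.le_self_pow (by omega) 2
  have hnj : j ≤ n := by
    have h1 : j * 1 ≤ (j + 1) * b j := Nat.mul_le_mul (by omega) (hb1 j)
    have h2 : (j + 1) * b j + b j + 1 < n := by rw [hn_pow]; exact Nat.lt_two_pow_self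
    omega
  refine ⟨n, hjN.trans hnj, ?_⟩
  have hden : 0 < δ n * Real.log n :=
    mul_pos (hpos n hn2) (Real.log_pos (by exact_mod_cast hn2))
  rw [le_div_iff₀ hden]
  obtain ⟨θ, hθ0, hθ1, hθ⟩ := exists_fourier_circleOfDigits_eq (ω := ω) (a := (j + 1) * b j)
    (b := b j) fun i h1 h2 => hω i (Or.inr ⟨j, h1, h2⟩)
  have hlow := log_le_norm_fourierPartialSum_fejerPoly (m := 2 ^ ((j + 1) * b j)) (K := 2 ^ b j)
    (by positivity) (circleOfDigits ω) hθ0 hθ1 hθ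
  have hser := le_norm_fourierPartialSum_fejerSeries (m := fun j => 2 ^ ((j + 1) * b j))
    (K := fun j => 2 ^ b j) (fun i j hij => by
      rw [← pow_add, ← pow_add, ← pow_succ']
      refine Nat.pow_lt_pow_right (by norm_num) ?_
      have h1 := hmono hij
      have h2 : (i + 1 + 1) * b j ≤ (j + 1) * b j := Nat.mul_le_mul_right _ (by omega)
      have h3 : (i + 1) * b i ≤ (i + 1) * b j := Nat.mul_le_mul_left _ h1.le
      have h4 := hb1 j
      nlinarith) j (circleOfDigits ω)
  have h3 := hb3 j
  have h5 : (2 : ℝ)⁻¹ ^ j * (Real.log ((2 ^ b j : ℕ) + 1) / 2) ≤ 2⁻¹ ^ j *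
      ‖fourierPartialSumCLM n (circleOfDigits ω)
        (fejerPoly (2 ^ ((j + 1) * b j)) (2 ^ b j))‖ := by
    gcongr
  have h6 : M * (δ n * Real.log n) ≤ j * (δ n * Real.log n) := by gcongr
  rw [← fourierPartialSumCLM_apply]
  exact h6.trans (h3.trans ((sub_le_sub_right h5 24).trans hser))

/-! ### Probe segment and Fubini -/

lemma dimH_unitAddCircle_le_one (E : Set UnitAddCircle) : dimH E ≤ 1 := by
  have hL : LipschitzWith 1 ((↑) : ℝ → UnitAddCircle) := by
    refine LipschitzWith.of_dist_le_mul fun x y => ?_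
    rw [NNReal.coe_one, one_mul, dist_eq_norm, dist_eq_norm, ← AddCircle.coe_sub]
    exact QuotientAddGroup.norm_mk_le_norm
  calc dimH E ≤ dimH (((↑) : ℝ → UnitAddCircle) '' Set.univ) := by
        refine dimH_mono fun x _ => ?_
        obtain ⟨y, rfl⟩ := QuotientAddGroup.mk_surjective x
        exact ⟨y, trivial, rfl⟩
    _ ≤ dimH (Set.univ : Set ℝ) := hL.dimH_image_le _
    _ = 1 := Real.dimH_univ

/-- The upper growth rate of the partial sums at a point relative to `δ n * log n`. -/
noncomputable def divergenceRate (δ : ℕ → ℝ) (f : C(UnitAddCircle, ℂ)) (x : UnitAddCircle) :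
    EReal :=
  limsup (fun n : ℕ => ((‖fourierPartialSum n f x‖ / (δ n * Real.log n) : ℝ) : EReal)) atTop

/-- On a line in direction `h`, at most one function has finite divergence rate at a point where
`h` has infinite divergence rate. -/
lemma divergenceRate_line_subsingleton {δ : ℕ → ℝ} (hpos : ∀ n : ℕ, 2 ≤ n → 0 < δ n)
    {h : C(UnitAddCircle, ℂ)} {x : UnitAddCircle} (hx : divergenceRate δ h x = ⊤)
    (g : C(UnitAddCircle, ℂ)) :
    {t : ℝ | divergenceRate δ (g + (t : ℂ) • h) x ≠ ⊤}.Subsingleton := by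
  intro s hs t ht
  by_contra hst
  simp only [Set.mem_ofPred_eq, divergenceRate, ne_eq, limsup_coe_eq_top_iff, not_forall,
    not_frequently, not_le] at hs ht
  rw [divergenceRate, limsup_coe_eq_top_iff] at hx
  obtain ⟨M, hM⟩ := hs
  obtain ⟨M', hM'⟩ := ht
  have hd : 0 < |s - t| := abs_pos.mpr (sub_ne_zero.mpr hst)
  -- Subtracting the two functions leaves `(s - t) • h`, so bounds for both would bound `h`.
  refine hx ((M + M') / |s - t|) ?_
  filter_upwards [hM, hM', eventually_ge_atTop 2] with n h1 h2 hn
  have hden : 0 < δ n * Real.log n :=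
    mul_pos (hpos n hn) (Real.log_pos (by exact_mod_cast hn))
  rw [div_lt_iff₀ hden] at h1 h2
  rw [not_le, div_lt_iff₀ hden, div_mul_eq_mul_div, lt_div_iff₀ hd]
  have e : fourierPartialSum n (g + (s : ℂ) • h) x - fourierPartialSum n (g + (t : ℂ) • h) x =
      ((s - t : ℝ) : ℂ) * fourierPartialSum n h x := by
    simp only [← fourierPartialSumCLM_apply, map_add, map_smul, smul_eq_mul]
    push_cast
    ring
  have h3 := norm_sub_le (fourierPartialSum n (g + (s : ℂ) • h) x)
    (fourierPartialSum n (g + (t : ℂ) • h) x)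
  rw [e, norm_mul, Complex.norm_real, Real.norm_eq_abs] at h3
  linarith

theorem theorem6 (δ : ℕ → ℝ) (hpos : ∀ n : ℕ, 2 ≤ n → 0 < δ n)
    (hlim : Tendsto δ atTop (𝓝 0)) :
    IsPrevalent {f : C(UnitAddCircle, ℂ) |
      ∃ E : Set UnitAddCircle, dimH E = 1 ∧ ∀ x ∈ E,
        limsup (fun n : ℕ =>
          ((‖fourierPartialSum n f x‖ / (δ n * Real.log n) : ℝ) : EReal)) atTop = ⊤} := by
  let _ : MeasurableSpace C(UnitAddCircle, ℂ) := borel _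
  have _ : BorelSpace C(UnitAddCircle, ℂ) := ⟨rfl⟩
  obtain ⟨Z, _, h, h0, hZ, hdiv⟩ := exists_divergent_on_sparse_digits hpos hlim
  set ν := sparseDigitMeasure Z
  have hmeas : Measurable fun p : C(UnitAddCircle, ℂ) × UnitAddCircle =>
      divergenceRate δ p.1 p.2 := by
    refine Measurable.limsup fun n => ?_
    exact ((continuous_fourierPartialSum n).norm.measurable.div_const _).coe_real_ereal
  have hset : MeasurableSet {p : C(UnitAddCircle, ℂ) × UnitAddCircle |
      divergenceRate δ p.1 p.2 ≠ ⊤} := hmeas (measurableSet_singleton ⊤).compl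
  -- A Borel set containing the exceptional functions: outside it divergence holds `ν`-almost
  -- everywhere, hence in dimension 1.
  set B : Set C(UnitAddCircle, ℂ) := {f | ν {x | divergenceRate δ f x ≠ ⊤} ≠ 0} with hB
  have hBm : MeasurableSet B :=
    (measurable_measure_prodMk_left (ν := ν) hset) (measurableSet_singleton 0).compl
  have hdiv_ae : ∀ᵐ x ∂ν, divergenceRate δ h x = ⊤ := by
    refine ae_sparseDigitMeasure (G := {x | divergenceRate δ h x = ⊤}) ?_ hdiv
    exact (hmeas.comp measurable_prodMk_left) (measurableSet_singleton ⊤)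
  refine ⟨B, fun f hf => ?_, hBm,
    (volume.restrict (Set.Icc (0 : ℝ) 1)).map fun t : ℝ => (t : ℂ) • h, ?_, ?_, fun g => ?_⟩
  · intro hfB
    refine hf ⟨{x | divergenceRate δ f x = ⊤}, le_antisymm (dimH_unitAddCircle_le_one _)
      (one_le_dimH_of_sparseDigitMeasure_ne_zero h0 hZ fun hzero => ?_), fun x hx => hx⟩
    have : ν Set.univ ≤ 0 := by
      rw [← Set.union_compl_self {x | divergenceRate δ f x = ⊤}]
      exact (measure_union_le _ _).trans (by rw [hzero, zero_add]; exact le_of_eq hfB)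
    simp [measure_univ] at this
  all_goals
    have hc : Continuous fun t : ℝ => (t : ℂ) • h :=
      Complex.continuous_ofReal.smul continuous_const
  · rw [Measure.map_apply hc.measurable MeasurableSet.univ]
    simp
  · refine ⟨(fun t : ℝ => (t : ℂ) • h) '' Set.Icc 0 1, isCompact_Icc.image hc, ?_⟩
    rw [Measure.map_apply hc.measurable (isCompact_Icc.image hc).measurableSet.compl,
      Measure.restrict_apply (hc.measurable (isCompact_Icc.image hc).measurableSet.compl)]
    refine measure_mono_null (t := ∅) (fun t ht => ht.1 ⟨t, ht.2, rfl⟩) measure_empty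
  · have htrans : g +ᵥ B = (fun f => -g + f) ⁻¹' B := by
      ext f
      rw [Set.mem_vadd_set_iff_neg_vadd_mem, vadd_eq_add, Set.mem_preimage]
    have hcomp : Continuous fun t : ℝ => -g + (t : ℂ) • h := continuous_const.add hc
    have hadd : Continuous fun f : C(UnitAddCircle, ℂ) => -g + f :=
      continuous_const.add continuous_id
    rw [htrans, Measure.map_apply hc.measurable (hadd.measurable hBm)]
    have hpair : MeasurableSet {p : ℝ × UnitAddCircle |
        divergenceRate δ (-g + (p.1 : ℂ) • h) p.2 = ⊤} :=
      (hmeas.comp ((hcomp.measurable.comp measurable_fst).prodMk measurable_snd))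
        (measurableSet_singleton ⊤)
    -- Fubini: for `ν`-almost every `x` the bad `t` form a subsingleton, which is Lebesgue-null.
    have hae := (Measure.ae_ae_comm (μ := volume.restrict (Set.Icc (0 : ℝ) 1)) (ν := ν)
      (p := fun t x => divergenceRate δ (-g + (t : ℂ) • h) x = ⊤) hpair).mpr (by
        filter_upwards [hdiv_ae] with x hx
        exact (divergenceRate_line_subsingleton hpos hx (-g)).measure_zero _)
    have : ∀ᵐ t : ℝ ∂volume.restrict (Set.Icc (0 : ℝ) 1), -g + (t : ℂ) • h ∉ B := by
      filter_upwards [hae] with t ht hmem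
      exact hmem ht
    simp only [ae_iff, not_not] at this
    exact this
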